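/- Let $\sigma$ be a finite relational signature all of whose relation symbols have positive arity, and let $d\in\mathbb N$. A $\sigma$-structure means a structure with a finite (possibly empty) universe. The degree of an element is the number of tuples (each counted together with its relation symbol) in the relations that contain it; the degree of a structure is the maximum degree of its elements; and $\mathcal C_{\sigma,d}$ is the class of $\sigma$-structures of degree at most $d$. A property $\mathcal P\subseteq\mathcal C_{\sigma,d}$ is a subclass closed under isomorphism; it is first-order definable on $\mathcal C_{\sigma,d}$ if there is a first-order sentence $\varphi$ (with equality) over $\sigma$ such that $\mathcal P=\{A\in\mathcal C_{\sigma,d} : A\models\varphi\}$. Distances in a structure $A$ are taken in its Gaifman graph, in which two distinct elements are adjacent if some tuple in a relation of $A$ contains both. For $r\in\mathbb N$ and $a\in A$, let $\mathcal N_r^A(a)$ be the substructure of $A$ induced by the elements at distance at most $r$ from $a$. An $r$-ball is a pair $(B,b)$ of a structure $B$ and an element $b\in B$ such that all elements of $B$ have distance at most $r$ from $b$. An $r$-type is an isomorphism class of $r$-balls (isomorphisms map centre to centre); it is of degree at most $d$ if its members lie in $\mathcal C_{\sigma,d}$. An element $a\in A$ has $r$-type $\tau$ if $(\mathcal N_r^A(a),a)\in\tau$.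 An $r$-neighbourhood profile of degree $d$ is a function $\rho$ assigning to each $r$-type $\tau$ of degree at most $d$ an interval $\rho(\tau)\subseteq\mathbb N$ of the form $[k,l]$ or $[k,\infty)$ with natural numbers $k\le l$. It defines the property $$\mathcal P_\rho=\{A\in\mathcal C_{\sigma,d} : |\{a\in A : a\text{ has }r\text{-type }\tau\}|\in\rho(\tau)\text{ for every }r\text{-type }\tau\text{ of degree at most }d\}.$$ Then for every non-empty property $\mathcal P\subseteq\mathcal C_{\sigma,d}$, the following are equivalent: 1. $\mathcal P$ is first-order definable on $\mathcal C_{\sigma,d}$; 2. there are $k\in\mathbb N$, radii $r_1,\dots,r_k\in\mathbb N$ and $r_i$-neighbourhood profiles $\rho_i$ of degree $d$ such that $\mathcal P=\bigcup_{1\le i\le k}\mathcal P_{\rho_i}$. -/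

import Mathlib

universe u v w

namespace NbhdProfile

open FirstOrder FirstOrder.Language.Structure

/-- A finite structure over the language `L`. The universe may be empty. -/
structure FinStruct (L : FirstOrder.Language.{u, v}) where
  /-- the universe of the structure -/
  carrier : Type w
  [str : L.Structure carrier]
  [fin : Finite carrier]

attribute [instance] FinStruct.str FinStruct.fin

instance (L : FirstOrder.Language.{u, v}) : CoeSort (FinStruct.{u, v, w} L) (Type w) :=
  ⟨FinStruct.carrier⟩

section Basic

variable {L : FirstOrder.Language.{u, v}}

/-- Two structures are isomorphic. -/
def Iso (A B : FinStruct.{u, v, w} L) : Prop := Nonempty (A ≃[L] B)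

/-- The tuples of `A` containing the element `a`; a tuple is recorded together with the
relation symbol to whose interpretation it belongs. -/
def tuplesAt (A : FinStruct.{u, v, w} L) (a : A) :
    Set (Σ R : (Σ n, L.Relations n), (Fin R.1 → A)) :=
  {p | RelMap p.1.2 p.2 ∧ a ∈ Set.range p.2}

/-- The degree of an element: the number of tuples containing it. -/
noncomputable def elemDegree (A : FinStruct.{u, v, w} L) (a : A) : ℕ∞ :=
  (tuplesAt A a).encard

/-- The degree of a structure: the maximum degree of its elements (`0` if there are none). -/
noncomputable def degree (A : FinStruct.{u, v, w} L) : ℕ∞ := ⨆ a : A, elemDegree A a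

variable (L) in
/-- The class of structures of degree at most `d`. -/
def boundedDegree (d : ℕ) : Set (FinStruct.{u, v, w} L) := {A | degree A ≤ d}

/-- A property of structures of degree at most `d`: an isomorphism-closed class of them. -/
def IsProperty (d : ℕ) (P : Set (FinStruct.{u, v, w} L)) : Prop :=
  P ⊆ boundedDegree L d ∧ ∀ A B : FinStruct.{u, v, w} L, Iso A B → A ∈ P → B ∈ P

/-- `P` is first-order definable on the class `C`: it consists of the models in `C` of some
first-order sentence. -/
def FODefinableOn (C P : Set (FinStruct.{u, v, w} L)) : Prop :=
  ∃ φ : L.Sentence, P = {A | A ∈ C ∧ A ⊨ φ}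

/-- The Gaifman graph: distinct elements are adjacent if some tuple contains both. -/
def gaifman (A : FinStruct.{u, v, w} L) : SimpleGraph A where
  Adj x y := x ≠ y ∧ ∃ (n : ℕ) (R : L.Relations n) (t : Fin n → A),
    RelMap R t ∧ x ∈ Set.range t ∧ y ∈ Set.range t
  symm := ⟨fun _ _ ⟨h, n, R, t, hR, hx, hy⟩ => ⟨h.symm, n, R, t, hR, hy, hx⟩⟩
  loopless := ⟨fun _ h => h.1 rfl⟩

/-- The set of elements at distance at most `r` from `a`. -/
def nbhd (A : FinStruct.{u, v, w} L) (r : ℕ) (a : A) : Set A :=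
  {b | (gaifman A).edist a b ≤ r}

theorem mem_nbhd_self (A : FinStruct.{u, v, w} L) (r : ℕ) (a : A) : a ∈ nbhd A r a := by
  simp [nbhd]

theorem mem_nbhd_iff (A : FinStruct.{u, v, w} L) (r : ℕ) (a b : A) :
    b ∈ nbhd A r a ↔ ∃ p : (gaifman A).Walk a b, p.length ≤ r := by
  constructor
  · intro h
    have hb : (gaifman A).edist a b ≤ r := h
    have hne : (gaifman A).edist a b ≠ ⊤ := fun h' => by simp [h'] at hb
    obtain ⟨p, hp⟩ := SimpleGraph.exists_walk_of_edist_ne_top hne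
    exact ⟨p, by rw [← hp] at hb; exact_mod_cast hb⟩
  · rintro ⟨p, hp⟩
    exact (SimpleGraph.edist_le p).trans (by exact_mod_cast hp)

end Basic

section Relational

variable {L : FirstOrder.Language.{u, v}} [L.IsRelational]

/-- The substructure of `A` induced by the subset `S`. -/
abbrev induced (A : FinStruct.{u, v, w} L) (S : Set A) : FinStruct.{u, v, w} L where
  carrier := S
  str :=
    { funMap := fun f _ => isEmptyElim f
      RelMap := fun R t => RelMap R fun i => (t i : A) }
  fin := Subtype.finite

variable (L) in
/-- An `r`-ball: a structure with a centre from which every element has distance at most `r`. -/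
structure Ball (r : ℕ) where
  /-- the underlying structure -/
  toStruct : FinStruct.{u, v, w} L
  /-- the centre -/
  center : toStruct
  nbhd_center : nbhd toStruct r center = Set.univ

/-- Isomorphism of `r`-balls: an isomorphism of structures mapping centre to centre. -/
instance ballSetoid (r : ℕ) : Setoid (Ball.{u, v, w} L r) where
  r B B' := ∃ e : B.toStruct ≃[L] B'.toStruct, e B.center = B'.center
  iseqv :=
    { refl := fun B => ⟨FirstOrder.Language.Equiv.refl L _, rfl⟩
      symm := fun {B B'} ⟨e, he⟩ => ⟨e.symm, by rw [← he]; exact e.symm_apply_apply _⟩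
      trans := fun {B B' B''} ⟨e, he⟩ ⟨f, hf⟩ => ⟨f.comp e, by
        rw [FirstOrder.Language.Equiv.comp_apply, he, hf]⟩ }

variable (L) in
/-- The `r`-types: the isomorphism classes of `r`-balls. -/
def RType (r : ℕ) : Type _ := Quotient (ballSetoid.{u, v, w} (L := L) r)

variable (L) in
/-- The `r`-types of structures of degree at most `d`. -/
def RTypeOfDegree (d r : ℕ) : Set (RType.{u, v, w} L r) :=
  {τ | ∃ B : Ball.{u, v, w} L r, B.toStruct ∈ boundedDegree L d ∧ Quotient.mk _ B = τ}

/-- The substructure induced by the `r`-neighbourhood of `a` has radius at most `r` around `a`. -/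
theorem nbhd_induced (A : FinStruct.{u, v, w} L) (r : ℕ) (a : A) :
    nbhd (induced A (nbhd A r a)) r ⟨a, mem_nbhd_self A r a⟩ = Set.univ := by
  have key : ∀ n : ℕ, n ≤ r → ∀ (x : A) (p : (gaifman A).Walk x a), p.length = n →
      ∀ hx : x ∈ nbhd A r a,
        ∃ q : (gaifman (induced A (nbhd A r a))).Walk ⟨x, hx⟩ ⟨a, mem_nbhd_self A r a⟩,
          q.length = n := by
    intro n
    induction n with
    | zero =>
      intro _ x p hp hx
      obtain rfl := SimpleGraph.Walk.eq_of_length_eq_zero hp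
      exact ⟨SimpleGraph.Walk.nil, rfl⟩
    | succ n ih =>
      intro hn x p hp hx
      cases p with
      | nil => simp at hp
      | @cons _ y _ h p =>
        have hp' : p.length = n := by simpa using hp
        have hy : y ∈ nbhd A r a := (mem_nbhd_iff A r a y).2
          ⟨p.reverse, by rw [SimpleGraph.Walk.length_reverse]; omega⟩
        obtain ⟨q, hq⟩ := ih (by omega) y p hp' hy
        obtain ⟨hne, k, R, t, hR, hxt, hyt⟩ := h
        have ht : ∀ i, t i ∈ nbhd A r a := by
          intro i
          by_cases hi : t i = y
          · rw [hi]; exact hy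
          · have hadj : (gaifman A).Adj (t i) y := ⟨hi, k, R, t, hR, ⟨i, rfl⟩, hyt⟩
            refine (mem_nbhd_iff A r a _).2 ⟨(SimpleGraph.Walk.cons hadj p).reverse, ?_⟩
            rw [SimpleGraph.Walk.length_reverse, SimpleGraph.Walk.length_cons]
            omega
        have hadj : (gaifman (induced A (nbhd A r a))).Adj ⟨x, hx⟩ ⟨y, hy⟩ := by
          refine ⟨fun h => hne (congrArg Subtype.val h), k, R, fun i => ⟨t i, ht i⟩, hR, ?_, ?_⟩
          · obtain ⟨i, hi⟩ := hxt
            exact ⟨i, Subtype.ext hi⟩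
          · obtain ⟨i, hi⟩ := hyt
            exact ⟨i, Subtype.ext hi⟩
        exact ⟨SimpleGraph.Walk.cons hadj q, by simp [hq]⟩
  refine Set.eq_univ_of_forall ?_
  rintro ⟨x, hx⟩
  obtain ⟨p, hp⟩ := (mem_nbhd_iff A r a x).1 hx
  obtain ⟨q, hq⟩ := key p.length hp x p.reverse (SimpleGraph.Walk.length_reverse p) hx
  exact (mem_nbhd_iff _ _ _ _).2
    ⟨q.reverse, ((SimpleGraph.Walk.length_reverse q).trans hq).le.trans hp⟩

/-- The `r`-ball around `a` in `A`: the substructure induced by the `r`-neighbourhood of `a`,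
with centre `a`. -/
def ballAt (A : FinStruct.{u, v, w} L) (r : ℕ) (a : A) : Ball.{u, v, w} L r where
  toStruct := induced A (nbhd A r a)
  center := ⟨a, mem_nbhd_self A r a⟩
  nbhd_center := nbhd_induced A r a

/-- The `r`-type of an element. -/
def typeOf (A : FinStruct.{u, v, w} L) (r : ℕ) (a : A) : RType.{u, v, w} L r :=
  Quotient.mk _ (ballAt A r a)

/-- The entry at `τ` of the histogram of `A`: the number of elements of `A` of `r`-type `τ`. -/
noncomputable def histogram (A : FinStruct.{u, v, w} L) {r : ℕ} (τ : RType.{u, v, w} L r) : ℕ :=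
  {a : A | typeOf A r a = τ}.ncard

/-- The intervals `[k, l]` and `[k, ∞)` of natural numbers, for natural numbers `k ≤ l`. -/
def intervals : Set (Set ℕ) :=
  {I | ∃ k l : ℕ, k ≤ l ∧ (I = Set.Icc k l ∨ I = Set.Ici k)}

variable (L) in
/-- An `r`-neighbourhood profile of degree `d`: an interval for every `r`-type of structures of
degree at most `d`. -/
abbrev Profile (d r : ℕ) : Type _ := RTypeOfDegree.{u, v, w} L d r → intervals

/-- The structures of degree at most `d` that obey the profile `ρ`. -/
def obeying {d r : ℕ} (ρ : Profile.{u, v, w} L d r) : Set (FinStruct.{u, v, w} L) :=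
  {A | A ∈ boundedDegree L d ∧
    ∀ τ : RTypeOfDegree.{u, v, w} L d r, histogram A τ.1 ∈ (ρ τ).1}

/-- `P` is a finite union of properties defined by neighbourhood profiles of degree `d`, whose
radii may differ. -/
def IsFiniteUnionOfProfiles (d : ℕ) (P : Set (FinStruct.{u, v, w} L)) : Prop :=
  ∃ (k : ℕ) (r : Fin k → ℕ) (ρ : ∀ i, Profile.{u, v, w} L d (r i)), P = ⋃ i, obeying (ρ i)

end Relational

end NbhdProfile

/-! From first-order logic to profiles the theorem is Hanf locality. On structures of degree at most
`d`, the truth of a sentence depends only on the numbers of elements of each `r`-type, cut off at a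
threshold `T` (`exists_models_iff_of_histogram`). Only finitely many `r`-types have degree at most
`d` (`finite_rTypeOfDegree`), so there are finitely many truncated histograms. Each is cut out by
one profile, and those realised by models of the sentence form the union.

Hanf locality is proved by induction on formulas, with tuples matched by a partial isomorphism
covering balls around them. The quantifier step is `TupleSim.exists_snoc`: an element near the tuple
is carried over by the partial isomorphism, while for a far one a counting argument yields a far
element of the same type in the other structure.

Conversely, an `r`-type is described by a formula that enumerates a finite ball, and "at least `k`
elements of type `τ`" by `k` quantifiers. Intervals are Boolean combinations of such thresholds, and
finitely many types and profiles leave a finite Boolean combination. -/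

namespace NbhdProfile

open FirstOrder FirstOrder.Language.Structure

/-! ### Balls in the Gaifman graph. -/

section Neighbourhoods

variable {L : FirstOrder.Language.{u, v}} {A B : FinStruct.{u, v, w} L}

theorem mem_nbhd_iff_edist_le {r : ℕ} {a b : A} :
    b ∈ nbhd A r a ↔ (gaifman A).edist a b ≤ r := Iff.rfl

theorem nbhd_mono {r s : ℕ} (h : r ≤ s) (a : A) : nbhd A r a ⊆ nbhd A s a := by
  intro x hx
  rw [mem_nbhd_iff_edist_le] at hx ⊢
  exact hx.trans (by exact_mod_cast h)

theorem mem_nbhd_comm {r : ℕ} {a b : A} : b ∈ nbhd A r a ↔ a ∈ nbhd A r b := by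
  rw [mem_nbhd_iff_edist_le, mem_nbhd_iff_edist_le, SimpleGraph.edist_comm]

theorem mem_nbhd_trans {r s : ℕ} {a b c : A} (hb : b ∈ nbhd A r a) (hc : c ∈ nbhd A s b) :
    c ∈ nbhd A (r + s) a := by
  have h : (gaifman A).edist a c ≤ (r : ℕ∞) + s :=
    SimpleGraph.edist_triangle.trans (add_le_add hb hc)
  simpa [nbhd] using h

theorem mem_nbhd_one_of_adj {a b : A} (h : (gaifman A).Adj a b) : b ∈ nbhd A 1 a :=
  (mem_nbhd_iff A 1 a b).2 ⟨h.toWalk, by simp⟩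

theorem mem_nbhd_zero {a b : A} : b ∈ nbhd A 0 a ↔ b = a := by
  rw [mem_nbhd_iff_edist_le, Nat.cast_zero, nonpos_iff_eq_zero, SimpleGraph.edist_eq_zero_iff,
    eq_comm]

theorem mem_nbhd_succ {r : ℕ} {a b : A} :
    b ∈ nbhd A (r + 1) a ↔ b ∈ nbhd A r a ∨ ∃ c ∈ nbhd A r a, (gaifman A).Adj c b := by
  constructor
  · intro h
    obtain ⟨p, hp⟩ := (mem_nbhd_iff A (r + 1) b a).1 (mem_nbhd_comm.1 h)
    cases p with
    | nil => exact Or.inl (mem_nbhd_self A r _)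
    | @cons _ c _ h p =>
      refine Or.inr ⟨c, mem_nbhd_comm.1 ((mem_nbhd_iff A r c a).2 ⟨p, ?_⟩), h.symm⟩
      simpa using hp
  · rintro (h | ⟨c, hc, h⟩)
    · exact nbhd_mono (Nat.le_succ r) a h
    · exact mem_nbhd_trans hc (mem_nbhd_one_of_adj h)

theorem mem_nbhd_one_of_relMap {n : ℕ} {R : L.Relations n} {t : Fin n → A} (h : RelMap R t)
    (i j : Fin n) : t j ∈ nbhd A 1 (t i) := by
  by_cases hij : t i = t j
  · rw [← hij]; exact mem_nbhd_self A 1 _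
  · exact mem_nbhd_one_of_adj ⟨hij, n, R, t, h, ⟨i, rfl⟩, ⟨j, rfl⟩⟩

end Neighbourhoods

/-! ### Partial isomorphisms covering balls, and their extension by one point. -/

section PartialIso

variable {L : FirstOrder.Language.{u, v}} {A B : FinStruct.{u, v, w} L}

/-- A partial isomorphism, given by its graph. -/
structure IsPartialIso (ρ : A → B → Prop) : Prop where
  eq_iff : ∀ {x y x' y'}, ρ x y → ρ x' y' → (x = x' ↔ y = y')
  relMap_iff : ∀ {n : ℕ} (R : L.Relations n) (t : Fin n → A) (t' : Fin n → B),
    (∀ i, ρ (t i) (t' i)) → (RelMap R t ↔ RelMap R t')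

theorem IsPartialIso.flip {ρ : A → B → Prop} (h : IsPartialIso ρ) :
    IsPartialIso (fun y x => ρ x y) where
  eq_iff h₁ h₂ := (h.eq_iff h₁ h₂).symm
  relMap_iff R t t' ht := (h.relMap_iff R t' t ht).symm

theorem IsPartialIso.mono {ρ σ : A → B → Prop} (h : IsPartialIso ρ)
    (hσ : ∀ x y, σ x y → ρ x y) : IsPartialIso σ where
  eq_iff h₁ h₂ := h.eq_iff (hσ _ _ h₁) (hσ _ _ h₂)
  relMap_iff R t t' ht := h.relMap_iff R t t' fun i => hσ _ _ (ht i)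

/-- A partial isomorphism defined on the `r`-neighbourhood of `x` does not increase distances
up to `r` from `x`. -/
theorem IsPartialIso.mem_nbhd {ρ : A → B → Prop} (h : IsPartialIso ρ) {x : A} {y : B}
    (hxy : ρ x y) {r : ℕ} (hdom : ∀ x' ∈ nbhd A r x, ∃ y', ρ x' y') :
    ∀ {x' y'}, x' ∈ nbhd A r x → ρ x' y' → y' ∈ nbhd B r y := by
  induction r with
  | zero =>
    intro x' y' hx' hρ
    rw [mem_nbhd_zero] at hx' ⊢
    exact (h.eq_iff hρ hxy).1 hx'
  | succ r ih =>
    intro x' y' hx' hρ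
    have ih' := @ih fun z hz => hdom z (nbhd_mono (Nat.le_succ r) x hz)
    rcases mem_nbhd_succ.1 hx' with hx' | ⟨z, hz, hne, n, R, t, hR, ⟨i, hi⟩, ⟨j, hj⟩⟩
    · exact nbhd_mono (Nat.le_succ r) y (ih' hx' hρ)
    · have ht : ∀ k, ∃ y', ρ (t k) y' := fun k =>
        hdom _ (mem_nbhd_trans hz (hi ▸ mem_nbhd_one_of_relMap hR i k))
      choose t' ht' using ht
      have hR' := (h.relMap_iff R t t' ht').1 hR
      have hj' : t' j = y' := (h.eq_iff (ht' j) hρ).1 hj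
      exact mem_nbhd_trans (ih' hz (hi ▸ ht' i)) (hj' ▸ mem_nbhd_one_of_relMap hR' i j)

/-- There is a partial isomorphism that matches the tuples `a` and `b` and whose domain and range
contain their respective `r`-neighbourhoods. -/
def TupleSim {ι : Type*} (r : ℕ) (a : ι → A) (b : ι → B) : Prop :=
  ∃ ρ : A → B → Prop, IsPartialIso ρ ∧ (∀ i, ρ (a i) (b i)) ∧
    (∀ i, ∀ x ∈ nbhd A r (a i), ∃ y, ρ x y) ∧ ∀ i, ∀ y ∈ nbhd B r (b i), ∃ x, ρ x y

theorem TupleSim.symm {ι : Type*} {r : ℕ} {a : ι → A} {b : ι → B} :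
    TupleSim r a b → TupleSim r b a :=
  fun ⟨ρ, h, hab, hA, hB⟩ => ⟨fun y x => ρ x y, h.flip, hab, hB, hA⟩

theorem TupleSim.mono {ι : Type*} {r s : ℕ} (hrs : r ≤ s) {a : ι → A} {b : ι → B} :
    TupleSim s a b → TupleSim r a b :=
  fun ⟨ρ, h, hab, hA, hB⟩ => ⟨ρ, h, hab, fun i x hx => hA i x (nbhd_mono hrs _ hx),
    fun i y hy => hB i y (nbhd_mono hrs _ hy)⟩

/-- There is a partial isomorphism that matches `a` and `b` and whose domain and range contain
their respective `r`-neighbourhoods. -/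
def PointSim (r : ℕ) (a : A) (b : B) : Prop := TupleSim r (fun _ : Unit => a) (fun _ => b)

theorem IsPartialIso.pointSim {ρ : A → B → Prop} (h : IsPartialIso ρ) {r : ℕ} {a : A} {b : B}
    (hab : ρ a b) (hA : ∀ x ∈ nbhd A r a, ∃ y, ρ x y) (hB : ∀ y ∈ nbhd B r b, ∃ x, ρ x y) :
    PointSim r a b :=
  ⟨ρ, h, fun _ => hab, fun _ => hA, fun _ => hB⟩

/-- Matching tuples can be extended by a matching pair of elements far away from them. -/
theorem TupleSim.snoc_of_far {n r : ℕ} {a : Fin n → A} {b : Fin n → B} (h : TupleSim r a b)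
    {x : A} {y : B} (hxy : PointSim r x y) (hx : ∀ i, x ∉ nbhd A (2 * r + 1) (a i))
    (hy : ∀ i, y ∉ nbhd B (2 * r + 1) (b i)) :
    TupleSim r (Fin.snoc a x : Fin (n + 1) → A) (Fin.snoc b y : Fin (n + 1) → B) := by
  obtain ⟨ρ, hρ, hab, hA, hB⟩ := h
  obtain ⟨σ, hσ, hσxy, hσA, hσB⟩ := hxy
  -- Since `r + 1 + r = 2 * r + 1`, the old and new `r`-balls are not only disjoint but also not
  -- joined by an edge.
  have dA : ∀ {i p q}, p ∈ nbhd A r (a i) → q ∈ nbhd A r x → q ∉ nbhd A 1 p := by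
    intro i p q hp hq hpq
    refine hx i ?_
    have := mem_nbhd_trans (mem_nbhd_trans hp hpq) (mem_nbhd_comm.1 hq)
    rwa [show r + 1 + r = 2 * r + 1 by ring] at this
  have dB : ∀ {i p q}, p ∈ nbhd B r (b i) → q ∈ nbhd B r y → q ∉ nbhd B 1 p := by
    intro i p q hp hq hpq
    refine hy i ?_
    have := mem_nbhd_trans (mem_nbhd_trans hp hpq) (mem_nbhd_comm.1 hq)
    rwa [show r + 1 + r = 2 * r + 1 by ring] at this
  -- Both maps may extend beyond the `r`-balls and conflict there, so they are restricted before
  -- being glued.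
  let ρ' : A → B → Prop := fun p q => ρ p q ∧ ∃ i, p ∈ nbhd A r (a i) ∧ q ∈ nbhd B r (b i)
  let σ' : A → B → Prop := fun p q => σ p q ∧ p ∈ nbhd A r x ∧ q ∈ nbhd B r y
  have hρ' : IsPartialIso ρ' := hρ.mono fun _ _ h => h.1
  have hσ' : IsPartialIso σ' := hσ.mono fun _ _ h => h.1
  have sep : ∀ {p q p' q'}, ρ' p q → σ' p' q' → p' ∉ nbhd A 1 p ∧ q' ∉ nbhd B 1 q := by
    rintro p q p' q' ⟨-, i, hp, hq⟩ ⟨-, hp', hq'⟩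
    exact ⟨dA hp hp', dB hq hq'⟩
  have ne : ∀ {p q p' q'}, ρ' p q → σ' p' q' → p ≠ p' ∧ q ≠ q' := by
    intro p q p' q' h h'
    exact ⟨fun e => (sep h h').1 (e ▸ mem_nbhd_self A 1 _),
      fun e => (sep h h').2 (e ▸ mem_nbhd_self B 1 _)⟩
  refine ⟨fun p q => ρ' p q ∨ σ' p q, ⟨?_, ?_⟩, ?_, ?_, ?_⟩
  · rintro p q p' q' (h | h) (h' | h')
    · exact hρ'.eq_iff h h'
    · exact iff_of_false (ne h h').1 (ne h h').2
    · exact iff_of_false (ne h' h).1.symm (ne h' h).2.symm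
    · exact hσ'.eq_iff h h'
  · intro m R t t' ht
    by_cases h₁ : ∀ i, ρ' (t i) (t' i)
    · exact hρ'.relMap_iff R t t' h₁
    by_cases h₂ : ∀ i, σ' (t i) (t' i)
    · exact hσ'.relMap_iff R t t' h₂
    -- A tuple meeting both pieces would join them by an edge, so the relation fails on both sides.
    push Not at h₁ h₂
    obtain ⟨j, hj⟩ := h₁
    obtain ⟨i, hi⟩ := h₂
    have h := sep ((ht i).resolve_right hi) ((ht j).resolve_left hj)
    exact iff_of_false (fun hR => h.1 (mem_nbhd_one_of_relMap hR i j))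
      (fun hR => h.2 (mem_nbhd_one_of_relMap hR i j))
  · intro i
    refine Fin.lastCases ?_ (fun i => ?_) i
    · simpa using Or.inr ⟨hσxy (), mem_nbhd_self A r x, mem_nbhd_self B r y⟩
    · simpa using Or.inl ⟨hab i, i, mem_nbhd_self A r _, mem_nbhd_self B r _⟩
  · intro i
    refine Fin.lastCases ?_ (fun i => ?_) i
    · intro p hp
      rw [Fin.snoc_last] at hp
      obtain ⟨q, hq⟩ := hσA () p hp
      exact ⟨q, Or.inr ⟨hq, hp, hσ.mem_nbhd (hσxy ()) (hσA ()) hp hq⟩⟩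
    · intro p hp
      rw [Fin.snoc_castSucc] at hp
      obtain ⟨q, hq⟩ := hA i p hp
      exact ⟨q, Or.inl ⟨hq, i, hp, hρ.mem_nbhd (hab i) (hA i) hp hq⟩⟩
  · intro i
    refine Fin.lastCases ?_ (fun i => ?_) i
    · intro q hq
      rw [Fin.snoc_last] at hq
      obtain ⟨p, hp⟩ := hσB () q hq
      exact ⟨p, Or.inr ⟨hp, hσ.flip.mem_nbhd (hσxy ()) (hσB ()) hq hp, hq⟩⟩
    · intro q hq
      rw [Fin.snoc_castSucc] at hq
      obtain ⟨p, hp⟩ := hB i q hq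
      exact ⟨p, Or.inl ⟨hp, i, hρ.flip.mem_nbhd (hab i) (hB i) hq hp, hq⟩⟩

/-- Matching tuples can be extended by any element close to one of them. -/
theorem TupleSim.exists_snoc_of_near {n r : ℕ} {a : Fin n → A} {b : Fin n → B}
    (h : TupleSim (3 * r + 1) a b) {x : A} {i : Fin n} (hx : x ∈ nbhd A (2 * r + 1) (a i)) :
    ∃ y, TupleSim r (Fin.snoc a x : Fin (n + 1) → A) (Fin.snoc b y : Fin (n + 1) → B) := by
  obtain ⟨ρ, hρ, hab, hA, hB⟩ := h
  obtain ⟨y, hxy⟩ := hA i x (nbhd_mono (by omega) _ hx)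
  have hy : y ∈ nbhd B (2 * r + 1) (b i) :=
    hρ.mem_nbhd (hab i) (fun p hp => hA i p (nbhd_mono (by omega) _ hp)) hx hxy
  -- The same `ρ` serves: `(2 * r + 1) + r = 3 * r + 1`, so it already covers the `r`-balls around
  -- `x` and `y`.
  refine ⟨y, ρ, hρ, fun j => ?_, fun j => ?_, fun j => ?_⟩
  · refine Fin.lastCases ?_ (fun j => ?_) j
    · simpa using hxy
    · simpa using hab j
  · refine Fin.lastCases ?_ (fun j => ?_) j
    · intro p hp
      rw [Fin.snoc_last] at hp
      exact hA i p (nbhd_mono (by omega) _ (mem_nbhd_trans hx hp))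
    · intro p hp
      rw [Fin.snoc_castSucc] at hp
      exact hA j p (nbhd_mono (by omega) _ hp)
  · refine Fin.lastCases ?_ (fun j => ?_) j
    · intro q hq
      rw [Fin.snoc_last] at hq
      exact hB i q (nbhd_mono (by omega) _ (mem_nbhd_trans hy hq))
    · intro q hq
      rw [Fin.snoc_castSucc] at hq
      exact hB j q (nbhd_mono (by omega) _ hq)

end PartialIso

/-! ### Types of elements and comparison of histograms. -/

section Types

variable {L : FirstOrder.Language.{u, v}} [L.IsRelational] {A B : FinStruct.{u, v, w} L}

/-- Neither a partial isomorphism nor its inverse increases distances from the centre up to `r`, so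
it restricts to an isomorphism between the two `r`-balls. This replaces an equality in a quotient by
a relation that can be restricted and glued. -/
theorem typeOf_eq_iff_pointSim {r : ℕ} {a : A} {b : B} :
    typeOf A r a = typeOf B r b ↔ PointSim r a b := by
  have h : typeOf A r a = typeOf B r b ↔
      ∃ e : (ballAt A r a).toStruct ≃[L] (ballAt B r b).toStruct,
        e (ballAt A r a).center = (ballAt B r b).center :=
    Quotient.eq (r := ballSetoid r)
  rw [h]
  constructor
  · rintro ⟨e, he⟩
    let e' : nbhd A r a ≃ nbhd B r b := e.toEquiv
    have hrel : ∀ {n} (R : L.Relations n) (t : Fin n → nbhd A r a),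
        RelMap R (fun i => (e' (t i) : B)) ↔ RelMap R (fun i => (t i : A)) :=
      fun R t => e.map_rel' R t
    refine IsPartialIso.pointSim
      (ρ := fun x y => ∃ hx : x ∈ nbhd A r a, (e' ⟨x, hx⟩ : B) = y) ⟨?_, ?_⟩ ?_ ?_ ?_
    · rintro x y x' y' ⟨hx, rfl⟩ ⟨hx', rfl⟩
      rw [← Subtype.ext_iff, e'.injective.eq_iff, Subtype.mk_eq_mk]
    · intro n R t t' ht
      choose ht ht' using ht
      have := hrel R fun i => ⟨t i, ht i⟩
      simp only [ht'] at this
      exact this.symm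
    · exact ⟨mem_nbhd_self A r a, congrArg Subtype.val he⟩
    · exact fun x hx => ⟨_, hx, rfl⟩
    · intro y hy
      exact ⟨e'.symm ⟨y, hy⟩, (e'.symm ⟨y, hy⟩).2, by simp⟩
  · rintro ⟨ρ, hρ, hab, hA, hB⟩
    have hf : ∀ x : nbhd A r a, ∃ y : nbhd B r b, ρ x y := fun x => by
      obtain ⟨y, hy⟩ := hA () x x.2
      exact ⟨⟨y, hρ.mem_nbhd (hab ()) (hA ()) x.2 hy⟩, hy⟩
    have hg : ∀ y : nbhd B r b, ∃ x : nbhd A r a, ρ x y := fun y => by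
      obtain ⟨x, hx⟩ := hB () y y.2
      exact ⟨⟨x, hρ.flip.mem_nbhd (hab ()) (hB ()) y.2 hx⟩, hx⟩
    choose f hf using hf
    choose g hg using hg
    have hrel : ∀ {n} (R : L.Relations n) (t : Fin n → nbhd A r a),
        RelMap R (fun i => (f (t i) : B)) ↔ RelMap R (fun i => (t i : A)) :=
      fun R t => (hρ.relMap_iff R _ _ fun i => hf (t i)).symm
    refine ⟨{ toFun := f, invFun := g,
              left_inv := fun x => Subtype.ext ((hρ.eq_iff (hg (f x)) (hf x)).2 rfl)
              right_inv := fun y => Subtype.ext ((hρ.eq_iff (hf (g y)) (hg y)).1 rfl)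
              map_fun' := fun F _ => isEmptyElim F
              map_rel' := fun R t => hrel R t }, ?_⟩
    exact Subtype.ext ((hρ.eq_iff (hf ⟨a, mem_nbhd_self A r a⟩) (hab ())).1 rfl)

theorem typeOf_eq_of_le {r s : ℕ} (hrs : r ≤ s) {a : A} {b : B}
    (h : typeOf A s a = typeOf B s b) : typeOf A r a = typeOf B r b :=
  typeOf_eq_iff_pointSim.2 ((typeOf_eq_iff_pointSim.1 h).mono hrs)

/-- Every set of at most `t` elements of `A` embeds into `B`, preserving `r`-types. -/
def HistLe (r t : ℕ) (A B : FinStruct.{u, v, w} L) : Prop :=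
  ∀ S : Set A, S.ncard ≤ t → ∃ f : S ↪ B, ∀ x, typeOf B r (f x) = typeOf A r (x : A)

theorem HistLe.mono {r s t t' : ℕ} (hrs : r ≤ s) (htt' : t ≤ t') (h : HistLe s t' A B) :
    HistLe r t A B := by
  intro S hS
  obtain ⟨f, hf⟩ := h S (hS.trans htt')
  exact ⟨f, fun x => typeOf_eq_of_le hrs (hf x)⟩

/-- The elements of each type are embedded separately, by cardinality, and the embeddings are
assembled over the fibres of `typeOf`. -/
theorem histLe_of_histogram {r t : ℕ}
    (h : ∀ x : A, min t (histogram A (typeOf A r x)) ≤ histogram B (typeOf A r x)) :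
    HistLe r t A B := by
  intro S hS
  have key : ∀ τ : RType.{u, v, w} L r,
      Nonempty ({x : S // typeOf A r (x : A) = τ} ↪ {y : B // typeOf B r y = τ}) := by
    intro τ
    rcases isEmpty_or_nonempty {x : S // typeOf A r (x : A) = τ} with hE | ⟨⟨x, rfl⟩⟩
    · exact ⟨⟨fun x => isEmptyElim x, fun x => isEmptyElim x⟩⟩
    · have h₁ : Nat.card {z : S // typeOf A r (z : A) = typeOf A r x} ≤ t :=
        (Finite.card_subtype_le _).trans hS
      have h₂ : Nat.card {z : S // typeOf A r (z : A) = typeOf A r x}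
          ≤ histogram A (typeOf A r x) :=
        Nat.card_le_card_of_injective
          (fun z => (⟨z.1.1, z.2⟩ : {a : A | typeOf A r a = typeOf A r x}))
          fun z z' hz => Subtype.ext (Subtype.ext (congrArg
            (fun p : {a : A | typeOf A r a = typeOf A r x} => (p : A)) hz))
      have h₃ : Nat.card {z : S // typeOf A r (z : A) = typeOf A r x}
          ≤ Nat.card {y : B // typeOf B r y = typeOf A r x} :=
        (le_min h₁ h₂).trans (h x)
      cases nonempty_fintype {z : S // typeOf A r (z : A) = typeOf A r x}
      cases nonempty_fintype {y : B // typeOf B r y = typeOf A r x}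
      rw [Nat.card_eq_fintype_card, Nat.card_eq_fintype_card] at h₃
      exact Function.Embedding.nonempty_of_card_le h₃
  have e := fun τ => (key τ).some
  refine ⟨((Equiv.sigmaFiberEquiv fun x : S => typeOf A r (x : A)).symm.toEmbedding.trans
    (Function.Embedding.sigmaMap (.refl _) fun τ => e τ)).trans
    (Equiv.sigmaFiberEquiv fun y : B => typeOf B r y).toEmbedding, fun x => ?_⟩
  exact (e (typeOf A r (x : A)) ⟨x, rfl⟩).2

end Types

/-! ### Finiteness consequences of bounded degree. -/

section Bounds

variable {L : FirstOrder.Language.{u, v}} [L.IsRelational]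

/-- The number of elements adjacent to a given one is bounded in terms of the degree. -/
theorem exists_ncard_adj_le (L : FirstOrder.Language.{u, v}) [Finite (Σ n, L.Relations n)]
    (d : ℕ) : ∃ N : ℕ, ∀ A ∈ boundedDegree.{u, v, w} L d, ∀ a : A,
      {b | (gaifman A).Adj a b}.ncard ≤ N := by
  -- `m` bounds the arities. Every neighbour of `a` is an entry of one of the at most `d` tuples at
  -- `a`, which leaves at most `d * m` of them.
  obtain ⟨m, hm⟩ := (Set.finite_range fun R : (Σ n, L.Relations n) => R.1).bddAbove
  refine ⟨d * m, fun A hA a => ?_⟩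
  have hd : (tuplesAt A a).encard ≤ d := (le_iSup (elemDegree A) a).trans hA
  have hfin : (tuplesAt A a).Finite := Set.finite_of_encard_le_coe hd
  have hd' : hfin.toFinset.card ≤ d := by
    rw [← Set.ncard_eq_toFinset_card _ hfin]
    rw [← hfin.cast_ncard_eq] at hd
    exact_mod_cast hd
  classical
  let F := hfin.toFinset.biUnion fun p => Finset.univ.image p.2
  have hF : F.card ≤ d * m := by
    refine (Finset.card_biUnion_le_card_mul _ _ m fun p _ => ?_).trans
      (Nat.mul_le_mul_right m hd')
    refine Finset.card_image_le.trans ?_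
    rw [Finset.card_univ, Fintype.card_fin]
    exact hm ⟨p.1, rfl⟩
  refine le_trans ?_ hF
  rw [← Set.ncard_coe_finset F]
  refine Set.ncard_le_ncard ?_ (Finset.finite_toSet F)
  rintro b ⟨-, n, R, t, hR, ha, ⟨i, hi⟩⟩
  simp only [F, Finset.coe_biUnion, Set.mem_iUnion, Finset.coe_image, Finset.coe_univ,
    Set.image_univ, Set.Finite.mem_toFinset, Finset.mem_coe]
  exact ⟨⟨⟨n, R⟩, t⟩, ⟨hR, ha⟩, ⟨i, hi⟩⟩

/-- The size of `r`-neighbourhoods is bounded in terms of `r` and the degree. -/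
theorem exists_ncard_nbhd_le (L : FirstOrder.Language.{u, v}) [Finite (Σ n, L.Relations n)]
    (d r : ℕ) : ∃ N : ℕ, ∀ A ∈ boundedDegree.{u, v, w} L d, ∀ a : A,
      (nbhd A r a).ncard ≤ N := by
  obtain ⟨m, hm⟩ := exists_ncard_adj_le.{u, v, w} L d
  induction r with
  | zero =>
    refine ⟨1, fun A _ a => ?_⟩
    rw [show nbhd A 0 a = {a} from Set.ext fun _ => mem_nbhd_zero, Set.ncard_singleton]
  | succ r ih =>
    obtain ⟨N, hN⟩ := ih
    refine ⟨N + N * m, fun A hA a => ?_⟩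
    classical
    cases nonempty_fintype A
    let S := (Set.toFinite (nbhd A r a)).toFinset
    have hS : S.card ≤ N := by
      rw [← Set.ncard_eq_toFinset_card]; exact hN A hA a
    let F := S.biUnion fun c => (Set.toFinite {b | (gaifman A).Adj c b}).toFinset
    have hF : F.card ≤ N * m := by
      refine (Finset.card_biUnion_le_card_mul _ _ m fun c _ => ?_).trans
        (Nat.mul_le_mul_right m hS)
      rw [← Set.ncard_eq_toFinset_card]
      exact hm A hA c
    have hsub : nbhd A (r + 1) a ⊆ ((S ∪ F : Finset A) : Set A) := by
      intro b hb
      rcases mem_nbhd_succ.1 hb with hb | ⟨c, hc, hcb⟩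
      · simp [S, hb]
      · simp only [F, Finset.coe_union, Set.mem_union, Finset.mem_coe, Finset.mem_biUnion]
        exact Or.inr ⟨c, by simpa [S] using hc, by simpa using hcb⟩
    calc (nbhd A (r + 1) a).ncard ≤ ((S ∪ F : Finset A) : Set A).ncard :=
          Set.ncard_le_ncard hsub (Finset.finite_toSet _)
      _ = (S ∪ F).card := Set.ncard_coe_finset _
      _ ≤ S.card + F.card := Finset.card_union_le _ _
      _ ≤ N + N * m := add_le_add hS hF

theorem induced_mem_boundedDegree {d : ℕ} {A : FinStruct.{u, v, w} L}
    (hA : A ∈ boundedDegree L d) (S : Set A) : induced A S ∈ boundedDegree L d := by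
  refine (iSup_le fun x => ?_ : degree (induced A S) ≤ d)
  refine le_trans ?_ ((le_iSup (elemDegree A) (x : A)).trans hA)
  refine Set.encard_le_encard_of_injOn
    (f := fun p => (⟨p.1, fun i => (p.2 i : A)⟩ : Σ R : (Σ n, L.Relations n), (Fin R.1 → A)))
    ?_ ?_
  · rintro p ⟨hp, i, hi⟩
    exact ⟨hp, i, congrArg Subtype.val hi⟩
  · rintro ⟨R, t⟩ - ⟨R', t'⟩ - h
    obtain rfl : R = R' := congrArg Sigma.fst h
    simp only [Sigma.mk.injEq, heq_eq_eq, true_and] at h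
    congr 1
    exact funext fun i => Subtype.ext (congrFun h i)

theorem typeOf_mem_rTypeOfDegree {d : ℕ} {A : FinStruct.{u, v, w} L}
    (hA : A ∈ boundedDegree L d) (r : ℕ) (a : A) : typeOf A r a ∈ RTypeOfDegree L d r :=
  ⟨ballAt A r a, induced_mem_boundedDegree hA _, rfl⟩

/-- There are finitely many `r`-types of bounded degree. -/
theorem finite_rTypeOfDegree (L : FirstOrder.Language.{u, v}) [L.IsRelational]
    [Finite (Σ n, L.Relations n)] (d r : ℕ) : Finite (RTypeOfDegree.{u, v, w} L d r) := by
  obtain ⟨N, hN⟩ := exists_ncard_nbhd_le.{u, v, w} L d r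
  -- A ball of degree at most `d` has at most `N` elements, so it can be copied onto some `Fin n`
  -- with `n ≤ N`. A code records the copied relations and centre, and balls with equal codes are
  -- isomorphic.
  let Code := Σ n : Fin (N + 1), ((R : Σ n, L.Relations n) → Set (Fin R.1 → Fin n)) × Fin n
  have key : ∀ τ : RTypeOfDegree.{u, v, w} L d r, ∃ c : Code, ∃ B : Ball.{u, v, w} L r,
      Quotient.mk _ B = τ.1 ∧ ∃ e : B.toStruct ≃ Fin c.1,
        e B.center = c.2.2 ∧ ∀ (R : Σ n, L.Relations n) (t : Fin R.1 → B.toStruct),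
          (fun i => e (t i)) ∈ c.2.1 R ↔ RelMap R.2 t := by
    rintro ⟨τ, B, hB, hτ⟩
    have hcard : Nat.card B.toStruct ≤ N := by
      have := hN _ hB B.center
      rwa [B.nbhd_center, Set.ncard_univ] at this
    let e := Finite.equivFin B.toStruct
    refine ⟨⟨⟨Nat.card B.toStruct, Nat.lt_succ_of_le hcard⟩,
      fun R => {t | RelMap R.2 fun i => e.symm (t i)}, e B.center⟩, B, hτ, e, rfl, ?_⟩
    intro R t
    simp
  choose c hc using key
  refine Finite.of_injective c fun τ τ' h => ?_
  have h₁ := hc τ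
  have h₂ := hc τ'
  rw [← h] at h₂
  obtain ⟨B, hB, e, he, hR⟩ := h₁
  obtain ⟨B', hB', e', he', hR'⟩ := h₂
  refine Subtype.ext (hB.symm.trans ((Quotient.sound ?_).trans hB'))
  refine ⟨{ toEquiv := e.trans e'.symm
            map_fun' := fun F _ => isEmptyElim F
            map_rel' := fun {n} R t => ?_ }, ?_⟩
  · rw [← hR ⟨n, R⟩ t, ← hR' ⟨n, R⟩]
    simp [Function.comp_def]
  · change e'.symm (e B.center) = B'.center
    rw [he, ← he', e'.symm_apply_apply]

end Bounds

/-! ### Hanf locality, and profiles from sentences. -/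

section Hanf

variable {L : FirstOrder.Language.{u, v}} [L.IsRelational]

/-- The back-and-forth step in Hanf's theorem. -/
theorem TupleSim.exists_snoc {n r N : ℕ} {A B : FinStruct.{u, v, w} L} {a : Fin n → A}
    {b : Fin n → B} (hN : ∀ c : A, (nbhd A (2 * r + 1) c).ncard ≤ N)
    (hist : HistLe r (n * N + 1) A B) (h : TupleSim (3 * r + 1) a b) (x : A) :
    ∃ y, TupleSim r (Fin.snoc a x : Fin (n + 1) → A) (Fin.snoc b y : Fin (n + 1) → B) := by
  by_cases hx : ∃ i, x ∈ nbhd A (2 * r + 1) (a i)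
  · obtain ⟨i, hi⟩ := hx
    exact h.exists_snoc_of_near hi
  push Not at hx
  suffices ∃ y, typeOf B r y = typeOf A r x ∧ ∀ i, y ∉ nbhd B (2 * r + 1) (b i) by
    obtain ⟨y, hy, hfar⟩ := this
    exact ⟨y, (h.mono (by omega)).snoc_of_far (typeOf_eq_iff_pointSim.1 hy.symm) hx hfar⟩
  -- Suppose every element of `B` of the type of `x` is near `b`. Then `f` sends `S` together with
  -- `x` to such elements, and the inverse of `ρ` sends these injectively back into `S`, so `|S| + 1
  -- ≤ |S|`. The threshold `n * N + 1` bounds `|S| + 1`.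
  by_contra hno
  push Not at hno
  obtain ⟨ρ, hρ, hab, hA, hB⟩ := h
  let S : Set A := {z | typeOf A r z = typeOf A r x ∧ ∃ i, z ∈ nbhd A (2 * r + 1) (a i)}
  have hS : S.ncard ≤ n * N := by
    calc S.ncard ≤ (⋃ i, nbhd A (2 * r + 1) (a i)).ncard :=
          Set.ncard_le_ncard (fun z hz => Set.mem_iUnion.2 hz.2) (Set.toFinite _)
      _ ≤ ∑ i, (nbhd A (2 * r + 1) (a i)).ncard := Set.ncard_iUnion_le_of_fintype _
      _ ≤ ∑ _i : Fin n, N := Finset.sum_le_sum fun i _ => hN _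
      _ = n * N := by simp
  have hxS : x ∉ S := fun hxS => hxS.2.elim fun i hi => hx i hi
  have hcard : (insert x S).ncard = S.ncard + 1 := Set.ncard_insert_of_notMem hxS
  obtain ⟨f, hf⟩ := hist (insert x S) (by omega)
  have hback : ∀ z : (insert x S : Set A), ∃ p ∈ S, ρ p (f z) := by
    intro z
    have hz : typeOf A r (z : A) = typeOf A r x := by
      rcases z.2 with hz | hz
      · rw [hz]
      · exact hz.1
    have hfz : typeOf B r (f z) = typeOf A r x := (hf z).trans hz
    obtain ⟨i, hi⟩ := hno (f z) hfz
    obtain ⟨p, hp⟩ := hB i (f z) (nbhd_mono (by omega) _ hi)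
    have hpi : p ∈ nbhd A (2 * r + 1) (a i) :=
      hρ.flip.mem_nbhd (hab i) (fun q hq => hB i q (nbhd_mono (by omega) _ hq)) hi hp
    refine ⟨p, ⟨?_, i, hpi⟩, hp⟩
    -- Here `ρ` preserves the `r`-type because its domain and range contain the `r`-balls around
    -- points at distance up to `2 * r + 1` from the tuples.
    rw [← hfz, typeOf_eq_iff_pointSim]
    refine hρ.pointSim hp (fun q hq => hA i q ?_) (fun q hq => hB i q ?_)
    · exact nbhd_mono (by omega) _ (mem_nbhd_trans hpi hq)
    · exact nbhd_mono (by omega) _ (mem_nbhd_trans hi hq)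
  choose g hgS hg using hback
  have hle : (insert x S).ncard ≤ S.ncard := by
    refine Nat.card_le_card_of_injective (fun z => (⟨g z, hgS z⟩ : S)) fun z z' hz => ?_
    have hz' : g z = g z' := Subtype.ext_iff.1 hz
    exact f.injective ((hρ.eq_iff (hg z) (hg z')).1 hz')
  omega

theorem exists_eq_var {n : ℕ} (t : L.Term (Empty ⊕ Fin n)) :
    ∃ i, t = FirstOrder.Language.Term.var (Sum.inr i) := by
  cases t with
  | var x =>
    cases x with
    | inl e => exact e.elim
    | inr i => exact ⟨i, rfl⟩
  | func f _ => exact isEmptyElim f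

/-- Hanf's theorem for formulas and structures of bounded degree. -/
theorem exists_realize_iff_of_histLe [Finite (Σ n, L.Relations n)] (d : ℕ) {n : ℕ}
    (φ : L.BoundedFormula Empty n) :
    ∃ r R T : ℕ, ∀ A ∈ boundedDegree.{u, v, w} L d, ∀ B ∈ boundedDegree.{u, v, w} L d,
      HistLe R T A B → HistLe R T B A → ∀ (a : Fin n → A) (b : Fin n → B), TupleSim r a b →
        (φ.Realize default a ↔ φ.Realize default b) := by
  induction φ with
  | falsum => exact ⟨0, 0, 0, fun _ _ _ _ _ _ _ _ _ => Iff.rfl⟩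
  | equal t₁ t₂ =>
    refine ⟨0, 0, 0, ?_⟩
    rintro A - B - - - a b ⟨ρ, hρ, hab, -, -⟩
    obtain ⟨i, rfl⟩ := exists_eq_var t₁
    obtain ⟨j, rfl⟩ := exists_eq_var t₂
    exact hρ.eq_iff (hab i) (hab j)
  | rel R ts =>
    refine ⟨0, 0, 0, ?_⟩
    rintro A - B - - - a b ⟨ρ, hρ, hab, -, -⟩
    have hts := fun k => exists_eq_var (ts k)
    choose i hi using hts
    obtain rfl : ts = fun k => _ := funext hi
    exact hρ.relMap_iff R (fun k => a (i k)) (fun k => b (i k)) fun k => hab (i k)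
  | imp φ ψ ihφ ihψ =>
    obtain ⟨r₁, R₁, T₁, h₁⟩ := ihφ
    obtain ⟨r₂, R₂, T₂, h₂⟩ := ihψ
    refine ⟨max r₁ r₂, max R₁ R₂, max T₁ T₂, fun A hA B hB hAB hBA a b hab => ?_⟩
    refine imp_congr (h₁ A hA B hB ?_ ?_ a b ?_) (h₂ A hA B hB ?_ ?_ a b ?_)
    · exact hAB.mono (le_max_left _ _) (le_max_left _ _)
    · exact hBA.mono (le_max_left _ _) (le_max_left _ _)
    · exact hab.mono (le_max_left _ _)
    · exact hAB.mono (le_max_right _ _) (le_max_right _ _)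
    · exact hBA.mono (le_max_right _ _) (le_max_right _ _)
    · exact hab.mono (le_max_right _ _)
  | @all n φ ih =>
    obtain ⟨r, R, T, h⟩ := ih
    obtain ⟨N, hN⟩ := exists_ncard_nbhd_le.{u, v, w} L d (2 * r + 1)
    -- These are the values `TupleSim.exists_snoc` needs to add one variable, combined with those
    -- for the body of the quantifier.
    refine ⟨3 * r + 1, max R r, max T (n * N + 1), fun A hA B hB hAB hBA a b hab => ?_⟩
    have hAB' := hAB.mono (le_max_left _ _) (le_max_left _ _)
    have hBA' := hBA.mono (le_max_left _ _) (le_max_left _ _)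
    rw [FirstOrder.Language.BoundedFormula.realize_all,
      FirstOrder.Language.BoundedFormula.realize_all]
    constructor
    · intro hφ y
      obtain ⟨x, hx⟩ := hab.symm.exists_snoc (hN B hB)
        (hBA.mono (le_max_right _ _) (le_max_right _ _)) y
      exact (h A hA B hB hAB' hBA' _ _ hx.symm).1 (hφ x)
    · intro hφ x
      obtain ⟨y, hy⟩ := hab.exists_snoc (hN A hA)
        (hAB.mono (le_max_right _ _) (le_max_right _ _)) x
      exact (h A hA B hB hAB' hBA' _ _ hy).2 (hφ y)

/-- On structures of bounded degree, whether a sentence holds depends only on the histogram of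
`r`-types cut off at some threshold. -/
theorem exists_models_iff_of_histogram [Finite (Σ n, L.Relations n)] [IsEmpty (L.Relations 0)]
    (d : ℕ) (φ : L.Sentence) :
    ∃ r T : ℕ, ∀ A ∈ boundedDegree.{u, v, w} L d, ∀ B ∈ boundedDegree.{u, v, w} L d,
      (∀ τ ∈ RTypeOfDegree.{u, v, w} L d r, min T (histogram A τ) = min T (histogram B τ)) →
        (A ⊨ φ ↔ B ⊨ φ) := by
  obtain ⟨s, r, T, h⟩ := exists_realize_iff_of_histLe.{u, v, w} d φ
  refine ⟨r, T, fun A hA B hB hAB => h A hA B hB ?_ ?_ _ _ ?_⟩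
  · exact histLe_of_histogram fun x =>
      (hAB _ (typeOf_mem_rTypeOfDegree hA r x)).le.trans (min_le_right _ _)
  · exact histLe_of_histogram fun x =>
      (hAB _ (typeOf_mem_rTypeOfDegree hB r x)).ge.trans (min_le_right _ _)
  -- The empty map matches the empty tuples. It is a partial isomorphism because there are no
  -- nullary relations, whose truth values no histogram would record.
  · refine ⟨fun _ _ => False, ⟨fun h => h.elim, ?_⟩, finZeroElim, finZeroElim, finZeroElim⟩
    intro n R t t' ht
    cases n with
    | zero => exact isEmptyElim R
    | succ n => exact (ht 0).elim

theorem isFiniteUnionOfProfiles_of_foDefinableOn [Finite (Σ n, L.Relations n)]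
    [IsEmpty (L.Relations 0)] {d : ℕ} {P : Set (FinStruct.{u, v, w} L)}
    (h : FODefinableOn (boundedDegree L d) P) : IsFiniteUnionOfProfiles d P := by
  obtain ⟨φ, rfl⟩ := h
  obtain ⟨r, T, hφ⟩ := exists_models_iff_of_histogram.{u, v, w} d φ
  have := finite_rTypeOfDegree.{u, v, w} L d r
  let cut : FinStruct.{u, v, w} L → RTypeOfDegree.{u, v, w} L d r → Fin (T + 1) :=
    fun A τ => ⟨min T (histogram A τ.1), Nat.lt_succ_of_le (min_le_left _ _)⟩
  let I := {c // ∃ A ∈ boundedDegree.{u, v, w} L d, A ⊨ φ ∧ cut A = c}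
  -- A truncated count below `T` is exact, and the value `T` means "at least `T`"; both are
  -- intervals.
  let ρ : I → Profile.{u, v, w} L d r := fun c τ =>
    if (c.1 τ : ℕ) < T then ⟨Set.Icc (c.1 τ) (c.1 τ), c.1 τ, c.1 τ, le_rfl, Or.inl rfl⟩
    else ⟨Set.Ici T, T, T, le_rfl, Or.inr rfl⟩
  have hρ : ∀ (c : I) A τ, histogram A τ.1 ∈ (ρ c τ).1 ↔ cut A τ = c.1 τ := by
    intro c A τ
    have hc := (c.1 τ).2
    rw [Fin.ext_iff]
    change _ ↔ min T (histogram A τ.1) = _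
    by_cases hlt : (c.1 τ : ℕ) < T
    · simp only [ρ, if_pos hlt, Set.mem_Icc]
      omega
    · simp only [ρ, if_neg hlt, Set.mem_Ici]
      omega
  let e := Finite.equivFin I
  refine ⟨Nat.card I, fun _ => r, fun i => ρ (e.symm i), ?_⟩
  ext A
  rw [Set.mem_iUnion]
  constructor
  · rintro ⟨hA, hAφ⟩
    refine ⟨e ⟨cut A, A, hA, hAφ, rfl⟩, hA, fun τ => ?_⟩
    rw [hρ, e.symm_apply_apply]
  · rintro ⟨i, hA, hi⟩
    obtain ⟨B, hB, hBφ, hcut⟩ := (e.symm i).2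
    refine ⟨hA, (hφ A hA B hB fun τ hτ => ?_).2 hBφ⟩
    have h := ((hρ _ _ _).1 (hi ⟨τ, hτ⟩)).trans (congrFun hcut ⟨τ, hτ⟩).symm
    exact Fin.ext_iff.1 h

end Hanf

/-! ### Sentences from profiles, through closure properties of definable relations. -/

section Definability

variable {L : FirstOrder.Language.{u, v}}

/-- A relation on tuples, given uniformly in all finite structures, is defined by a formula. -/
def UniformlyDefinable {α : Type*} (Q : ∀ A : FinStruct.{u, v, w} L, (α → A) → Prop) : Prop :=
  ∃ φ : L.Formula α, ∀ A v, φ.Realize v ↔ Q A v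

namespace UniformlyDefinable

variable {α β : Type*} {Q Q' : ∀ A : FinStruct.{u, v, w} L, (α → A) → Prop}

theorem congr (h : UniformlyDefinable Q) (hQ : ∀ A v, Q A v ↔ Q' A v) : UniformlyDefinable Q' :=
  h.imp fun _ hφ A v => (hφ A v).trans (hQ A v)

theorem not (h : UniformlyDefinable Q) : UniformlyDefinable fun A v => ¬ Q A v := by
  obtain ⟨φ, hφ⟩ := h
  exact ⟨φ.not, fun A v => by rw [FirstOrder.Language.Formula.realize_not, hφ]⟩

theorem and (h : UniformlyDefinable Q) (h' : UniformlyDefinable Q') :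
    UniformlyDefinable fun A v => Q A v ∧ Q' A v := by
  obtain ⟨φ, hφ⟩ := h
  obtain ⟨ψ, hψ⟩ := h'
  exact ⟨φ ⊓ ψ, fun A v => by rw [FirstOrder.Language.Formula.realize_inf, hφ, hψ]⟩

theorem or (h : UniformlyDefinable Q) (h' : UniformlyDefinable Q') :
    UniformlyDefinable fun A v => Q A v ∨ Q' A v :=
  (h.not.and h'.not).not.congr fun A v => by tauto

theorem imp (h : UniformlyDefinable Q) (h' : UniformlyDefinable Q') :
    UniformlyDefinable fun A v => Q A v → Q' A v :=
  (h.not.or h').congr fun A v => by tauto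

theorem iff (h : UniformlyDefinable Q) (h' : UniformlyDefinable Q') :
    UniformlyDefinable fun A v => (Q A v ↔ Q' A v) :=
  ((h.imp h').and (h'.imp h)).congr fun A v => by tauto

theorem false : UniformlyDefinable fun (A : FinStruct.{u, v, w} L) (_ : α → A) => False :=
  ⟨⊥, fun _ _ => Iff.rfl⟩

/-- Facts about a fixed ball, independent of `A`, enter formulas through this. -/
theorem const (p : Prop) :
    UniformlyDefinable fun (A : FinStruct.{u, v, w} L) (_ : α → A) => p := by
  by_cases hp : p
  · exact false.not.congr fun A v => by simp [hp]
  · exact false.congr fun A v => by simp [hp]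

theorem exists_fin {ι : Type*} [Finite ι]
    {Q : ι → ∀ A : FinStruct.{u, v, w} L, (α → A) → Prop} (h : ∀ i, UniformlyDefinable (Q i)) :
    UniformlyDefinable fun A v => ∃ i, Q i A v := by
  choose φ hφ using h
  exact ⟨FirstOrder.Language.BoundedFormula.iSup φ, fun A v => by
    rw [FirstOrder.Language.Formula.Realize, FirstOrder.Language.BoundedFormula.realize_iSup]
    exact exists_congr fun i => hφ i A v⟩

theorem forall_fin {ι : Type*} [Finite ι]
    {Q : ι → ∀ A : FinStruct.{u, v, w} L, (α → A) → Prop} (h : ∀ i, UniformlyDefinable (Q i)) :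
    UniformlyDefinable fun A v => ∀ i, Q i A v :=
  (exists_fin fun i => (h i).not).not.congr fun A v => by simp

/-- In `exists_fin` the index set is external and yields a finite disjunction; here the quantifiers
range over `A`, with `β` indexing a block of bound variables. -/
theorem exists_tuple [Finite β] {Q : ∀ A : FinStruct.{u, v, w} L, (α → A) → (β → A) → Prop}
    (h : UniformlyDefinable fun A (v : α ⊕ β → A) => Q A (v ∘ Sum.inl) (v ∘ Sum.inr)) :
    UniformlyDefinable fun A v => ∃ t, Q A v t := by
  obtain ⟨φ, hφ⟩ := h
  exact ⟨φ.iExs β, fun A v => by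
    rw [FirstOrder.Language.Formula.realize_iExs]
    exact exists_congr fun t => hφ A _⟩

theorem exists_elem {Q : ∀ A : FinStruct.{u, v, w} L, (α → A) → A → Prop}
    (h : UniformlyDefinable fun A (v : α ⊕ Unit → A) => Q A (v ∘ Sum.inl) (v (Sum.inr ()))) :
    UniformlyDefinable fun A v => ∃ x, Q A v x :=
  (exists_tuple (Q := fun _ w (t : Unit → _) => Q _ w (t ())) h).congr fun _ _ =>
    ⟨fun ⟨t, ht⟩ => ⟨t (), ht⟩, fun ⟨x, hx⟩ => ⟨fun _ => x, hx⟩⟩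

theorem forall_elem {Q : ∀ A : FinStruct.{u, v, w} L, (α → A) → A → Prop}
    (h : UniformlyDefinable fun A (v : α ⊕ Unit → A) => Q A (v ∘ Sum.inl) (v (Sum.inr ()))) :
    UniformlyDefinable fun A v => ∀ x, Q A v x :=
  (exists_elem (Q := fun A v x => ¬ Q A v x) h.not).not.congr fun A v => by simp

theorem eq (i j : α) :
    UniformlyDefinable fun (A : FinStruct.{u, v, w} L) (v : α → A) => v i = v j :=
  ⟨(FirstOrder.Language.Term.var i).equal (FirstOrder.Language.Term.var j), fun A v => by
    rw [FirstOrder.Language.Formula.realize_equal]; rfl⟩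

theorem relMap {n : ℕ} (R : L.Relations n) (i : Fin n → α) :
    UniformlyDefinable fun (A : FinStruct.{u, v, w} L) (v : α → A) => RelMap R fun k => v (i k) :=
  ⟨R.formula fun k => FirstOrder.Language.Term.var (i k), fun A v => by
    rw [FirstOrder.Language.Formula.realize_rel]; rfl⟩

variable [Finite (Σ n, L.Relations n)]

theorem adj (i j : α) : UniformlyDefinable fun (A : FinStruct.{u, v, w} L) (v : α → A) =>
    (gaifman A).Adj (v i) (v j) := by
  refine ((eq i j).not.and (exists_fin fun R : (Σ n, L.Relations n) =>
    exists_tuple (β := Fin R.1)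
      (Q := fun A v t => RelMap R.2 t ∧ (∃ k, t k = v i) ∧ ∃ k, t k = v j)
      ((relMap R.2 Sum.inr).and ((exists_fin fun k => eq (Sum.inr k) (Sum.inl i)).and
        (exists_fin fun k => eq (Sum.inr k) (Sum.inl j)))))).congr fun A v => ?_
  exact and_congr Iff.rfl ⟨fun ⟨R, t, h⟩ => ⟨R.1, R.2, t, h⟩, fun ⟨n, R, t, h⟩ => ⟨⟨n, R⟩, t, h⟩⟩

theorem mem_nbhd (r : ℕ) (i j : α) :
    UniformlyDefinable fun (A : FinStruct.{u, v, w} L) (v : α → A) => v j ∈ nbhd A r (v i) := by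
  -- The intermediate point is a new variable, so the induction hypothesis is applied with `α ⊕
  -- Unit`.
  induction r generalizing α with
  | zero => exact (eq j i).congr fun A v => mem_nbhd_zero.symm
  | succ r ih =>
    refine ((ih i j).or (exists_elem
      (Q := fun A v c => c ∈ nbhd A r (v i) ∧ (gaifman A).Adj c (v j))
      ((ih (Sum.inl i) (Sum.inr ())).and (adj (Sum.inr ()) (Sum.inl j))))).congr fun A v => ?_
    exact mem_nbhd_succ.symm

variable [L.IsRelational]

theorem typeOf_eq {r : ℕ} (τ : RType.{u, v, w} L r) (i : α) :
    UniformlyDefinable fun (A : FinStruct.{u, v, w} L) (v : α → A) => typeOf A r (v i) = τ := by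
  obtain ⟨B, rfl⟩ := Quotient.exists_rep τ
  -- The tuple `f`, indexed by the finite ball `B`, is an isomorphism from `B` onto the `r`-ball of
  -- `v i`: it respects centres, is injective, has exactly that ball as range, and preserves and
  -- reflects relations.
  refine (exists_tuple (β := B.toStruct)
    (Q := fun A v f => f B.center = v i ∧
      (∀ p : B.toStruct × B.toStruct, f p.1 = f p.2 → p.1 = p.2) ∧
      (∀ y, y ∈ nbhd A r (v i) ↔ ∃ b, f b = y) ∧
      ∀ R : (Σ n, L.Relations n), ∀ t : Fin R.1 → B.toStruct,
        RelMap R.2 (fun k => f (t k)) ↔ RelMap R.2 t)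
    ((eq _ _).and (.and (forall_fin fun p => (eq (Sum.inr p.1) (Sum.inr p.2)).imp (const _))
      (.and (forall_elem (Q := fun A v y => y ∈ nbhd A r (v (Sum.inl i)) ↔ ∃ b, v (Sum.inr b) = y)
          ((mem_nbhd r _ _).iff (exists_fin fun b => eq (Sum.inl (Sum.inr b)) (Sum.inr ()))))
        (forall_fin fun R => forall_fin fun t => (relMap R.2 _).iff (const _)))))).congr
    fun A v => ?_
  have h : typeOf A r (v i) = Quotient.mk _ B ↔
      ∃ e : (ballAt A r (v i)).toStruct ≃[L] B.toStruct,
        e (ballAt A r (v i)).center = B.center :=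
    Quotient.eq (r := ballSetoid r)
  refine Iff.trans ?_ h.symm
  constructor
  · rintro ⟨f, hc, hinj, hran, hrel⟩
    have hinj : Function.Injective f := fun b b' h => hinj (b, b') h
    have hbij : Function.Bijective
        fun b : B.toStruct => (⟨f b, (hran _).2 ⟨b, rfl⟩⟩ : nbhd A r (v i)) :=
      ⟨fun b b' h => hinj (Subtype.ext_iff.1 h), fun y => by
        obtain ⟨b, hb⟩ := (hran y).1 y.2
        exact ⟨b, Subtype.ext hb⟩⟩
    let e : B.toStruct ≃[L] (ballAt A r (v i)).toStruct :=
      { toEquiv := Equiv.ofBijective _ hbij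
        map_fun' := fun F _ => isEmptyElim F
        map_rel' := fun {n} R t => hrel ⟨n, R⟩ t }
    have he : e B.center = (ballAt A r (v i)).center := Subtype.ext hc
    exact ⟨e.symm, by rw [← he, e.symm_apply_apply]⟩
  · rintro ⟨e, he⟩
    let e' : nbhd A r (v i) ≃ B.toStruct := e.toEquiv
    refine ⟨fun b => (e'.symm b : A), ?_, ?_, ?_, ?_⟩
    · rw [← he]
      exact congrArg Subtype.val (e'.symm_apply_apply _)
    · exact fun p hp => e'.symm.injective (Subtype.ext hp)
    · intro y
      exact ⟨fun hy => ⟨e' ⟨y, hy⟩, congrArg Subtype.val (e'.symm_apply_apply _)⟩, by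
        rintro ⟨b, rfl⟩; exact (e'.symm b).2⟩
    · exact fun R t => e.symm.map_rel' R.2 t

theorem le_histogram {r : ℕ} (τ : RType.{u, v, w} L r) (k : ℕ) :
    UniformlyDefinable fun (A : FinStruct.{u, v, w} L) (_ : α → A) => k ≤ histogram A τ := by
  refine (exists_tuple (β := Fin k)
    (Q := fun A _ t => (∀ p : Fin k × Fin k, t p.1 = t p.2 → p.1 = p.2) ∧
      ∀ i, typeOf A r (t i) = τ)
    (.and (forall_fin fun p : Fin k × Fin k => (eq (Sum.inr p.1) (Sum.inr p.2)).imp (const _))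
      (forall_fin fun i => typeOf_eq τ (Sum.inr i)))).congr fun A v => ?_
  constructor
  · rintro ⟨t, hinj, ht⟩
    have := Nat.card_le_card_of_injective (fun i => (⟨t i, ht i⟩ : {a : A | typeOf A r a = τ}))
      fun i j h => hinj (i, j) (Subtype.ext_iff.1 h)
    rwa [Nat.card_fin] at this
  · intro hk
    let e := Finite.equivFin {a : A | typeOf A r a = τ}
    refine ⟨fun i => e.symm (Fin.castLE hk i), fun p hp => ?_, fun i => (e.symm _).2⟩
    exact Fin.castLE_injective hk (e.symm.injective (Subtype.ext hp))

theorem histogram_mem {r : ℕ} (τ : RType.{u, v, w} L r) {I : Set ℕ} (hI : I ∈ intervals) :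
    UniformlyDefinable fun (A : FinStruct.{u, v, w} L) (_ : α → A) => histogram A τ ∈ I := by
  obtain ⟨k, l, -, rfl | rfl⟩ := hI
  · refine ((le_histogram τ k).and (le_histogram τ (l + 1)).not).congr fun A v => ?_
    rw [Set.mem_Icc, not_le, Nat.lt_succ_iff]
  · exact (le_histogram τ k).congr fun _ _ => Iff.rfl

end UniformlyDefinable

theorem foDefinableOn_of_isFiniteUnionOfProfiles [L.IsRelational] [Finite (Σ n, L.Relations n)]
    {d : ℕ} {P : Set (FinStruct.{u, v, w} L)} (h : IsFiniteUnionOfProfiles d P) :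
    FODefinableOn (boundedDegree L d) P := by
  obtain ⟨k, r, ρ, rfl⟩ := h
  have := fun i => finite_rTypeOfDegree.{u, v, w} L d (r i)
  obtain ⟨φ, hφ⟩ := UniformlyDefinable.exists_fin (α := Empty) fun i : Fin k =>
    UniformlyDefinable.forall_fin fun τ : RTypeOfDegree.{u, v, w} L d (r i) =>
      UniformlyDefinable.histogram_mem (α := Empty) τ.1 (ρ i τ).2
  refine ⟨φ, ?_⟩
  ext A
  rw [Set.mem_iUnion]
  -- A formula with free variables in `Empty` is a sentence, and `default` is its only assignment.
  have h : A ⊨ φ ↔ _ := hφ A default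
  constructor
  · rintro ⟨i, hA, hi⟩
    exact ⟨hA, h.2 ⟨i, hi⟩⟩
  · rintro ⟨hA, hAφ⟩
    obtain ⟨i, hi⟩ := h.1 hAφ
    exact ⟨i, hA, hi⟩

end Definability

end NbhdProfile

theorem lemma3p2 (L : FirstOrder.Language.{u, v}) [L.IsRelational]
    [Finite (Σ n, L.Relations n)] [IsEmpty (L.Relations 0)] (d : ℕ)
    (P : Set (NbhdProfile.FinStruct.{u, v, w} L)) (hP : NbhdProfile.IsProperty d P)
    (hne : P.Nonempty) :
    NbhdProfile.FODefinableOn (NbhdProfile.boundedDegree L d) P ↔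
      NbhdProfile.IsFiniteUnionOfProfiles d P :=
  ⟨NbhdProfile.isFiniteUnionOfProfiles_of_foDefinableOn,
    NbhdProfile.foDefinableOn_of_isFiniteUnionOfProfiles⟩
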